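/- Let $(\Omega,\Sigma,\mu)$ be a measure space, $1\le p<\infty$, $\frac1p+\frac1q=1$, and $O\subseteq\mathbb{C}^d$ open. For a complex Banach space $E$ let $\mathrm{H}^\infty(O;E)$ be the space of bounded holomorphic (i.e. complex Fréchet-differentiable) functions $O\to E$ with the supremum norm, and $\mathrm{H}^\infty(O):=\mathrm{H}^\infty(O;\mathbb{C})$. A linear functional $\varphi:\mathrm{H}^\infty(O)\to\mathbb{C}$ is called bp-continuous if $\varphi(g_n)\to\varphi(g)$ whenever $g_n,g\in\mathrm{H}^\infty(O)$, $g_n\to g$ pointwise on $O$ and $\sup_n\|g_n\|_\infty<\infty$; such a functional is norm-bounded, and $\|\varphi\|$ denotes its norm in the dual of $\mathrm{H}^\infty(O)$. For a multi-index $\alpha\in\mathbb{N}_0^d$ write $D^\alpha=\prod_{j}\partial^{\alpha_j}/\partial z_j^{\alpha_j}$ and $D^\alpha_zf(a,t)=D^\alpha(f(\cdot,t))(a)$. Let $f:O\times\Omega\to\mathbb{C}$ be a function such that - for every $z\in O$ the function $F(z):=f(z,\cdot)$ is measurable, and $\sup_{z\in O}\int_\Omega|f(z,t)|^p\,\mu(\mathrm{d}t)<\infty$;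 - for every $t\in\Omega$ the function $f_t:=f(\cdot,t)$ is bounded and holomorphic on $O$. Then for every $\alpha\in\mathbb{N}_0^d$, every $a\in O$ and every bp-continuous linear functional $\varphi:\mathrm{H}^\infty(O)\to\mathbb{C}$ the following hold. (a) $F\in\mathrm{H}^\infty(O;L^p(\Omega))$ and $D^\alpha F(a)=D^\alpha_zf(a,\cdot)$ $\mu$-almost everywhere. (b) For each $h\in L^q(\Omega)$ the function $z\mapsto\int_\Omega f(z,t)h(t)\,\mu(\mathrm{d}t)$ is holomorphic on $O$, the function $D^\alpha_zf(a,\cdot)h$ is integrable, and $$D^\alpha\Bigl(z\mapsto\int_\Omega f(z,t)h(t)\,\mu(\mathrm{d}t)\Bigr)(a)=\int_\Omega D^\alpha_zf(a,t)\,h(t)\,\mu(\mathrm{d}t).$$ (c) The function $t\mapsto\varphi(f_t)$ is measurable and $p$-integrable with $$\Bigl(\int_\Omega|\varphi(f_t)|^p\,\mu(\mathrm{d}t)\Bigr)^{1/p}\le\|\varphi\|\,\sup_{z\in O}\|F(z)\|_p,$$ and its class belongs to the closed linear span of $F(O)$ in $L^p(\Omega)$. (d) For all $h\in L^q(\Omega)$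 the function $t\mapsto\varphi(f_t)h(t)$ is integrable, the function $z\mapsto\int_\Omega f(z,t)h(t)\,\mu(\mathrm{d}t)$ belongs to $\mathrm{H}^\infty(O)$, and $$\int_\Omega\varphi(f_t)h(t)\,\mu(\mathrm{d}t)=\varphi\Bigl(z\mapsto\int_\Omega f(z,t)h(t)\,\mu(\mathrm{d}t)\Bigr).$$ -/

import Mathlib

open MeasureTheory Filter Topology BoundedContinuousFunction
open scoped ENNReal

noncomputable section

namespace HolFubini

variable {d : ℕ} {O : TopologicalSpace.Opens (Fin d → ℂ)}
set_option linter.unusedSectionVars false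

variable {E : Type*} [NormedAddCommGroup E] [NormedSpace ℂ E]

/-- Extension by zero of a function on the open set `O ⊆ ℂ^d` to all of `ℂ^d`. Only the values on
`O` matter below, since differentiability and derivatives are taken at points of the open set
`O`. -/
def zeroExt (g : O → E) : (Fin d → ℂ) → E :=
  Function.extend (fun z : O => (z : Fin d → ℂ)) g 0

theorem zeroExt_apply (g : O → E) (z : O) : zeroExt g z = g z :=
  Subtype.val_injective.extend_apply g 0 z

theorem zeroExt_of_notMem (g : O → E) {z : Fin d → ℂ} (hz : z ∉ O) : zeroExt g z = 0 := by
  unfold zeroExt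
  rw [Function.extend_apply']
  · rfl
  · rintro ⟨a, ha⟩
    exact hz (ha ▸ a.2)

/-- `g : O → E` is holomorphic: Fréchet-differentiable over `ℂ` at each point of `O`. -/
def IsHolomorphic (g : O → E) : Prop :=
  ∀ a : O, DifferentiableAt ℂ (zeroExt g) (a : Fin d → ℂ)

/-- The complex partial derivative `∂g/∂z_j`. -/
def partialDeriv (j : Fin d) (g : (Fin d → ℂ) → E) : (Fin d → ℂ) → E :=
  fun z => lineDeriv ℂ g z (Pi.single j 1)

/-- `D^α g = ∂_1^{α_1} ⋯ ∂_d^{α_d} g` on `O`, for a multi-index `α`. -/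
def multiDeriv (α : Fin d → ℕ) (g : O → E) : O → E := fun a =>
  (List.finRange d).foldr (fun j u => (partialDeriv j)^[α j] u) (zeroExt g) a

theorem IsHolomorphic.continuous {g : O → E} (hg : IsHolomorphic g) : Continuous g := by
  rw [continuous_iff_continuousAt]
  intro a
  have h : ContinuousAt (fun z : O => zeroExt g z) a :=
    ContinuousAt.comp (f := fun z : O => (z : Fin d → ℂ)) (hg a).continuousAt
      continuous_subtype_val.continuousAt
  simpa only [zeroExt_apply] using h

theorem zeroExt_add (g₁ g₂ : O → E) : zeroExt (g₁ + g₂) = zeroExt g₁ + zeroExt g₂ := by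
  funext z
  by_cases hz : z ∈ O
  · have h := fun g : O → E => zeroExt_apply g ⟨z, hz⟩
    simp only at h
    simp [h]
  · simp [zeroExt_of_notMem _ hz]

theorem zeroExt_smul (c : ℂ) (g : O → E) : zeroExt (c • g) = c • zeroExt g := by
  funext z
  by_cases hz : z ∈ O
  · have h := fun g : O → E => zeroExt_apply g ⟨z, hz⟩
    simp only at h
    simp [h]
  · simp [zeroExt_of_notMem _ hz]

variable (O E) in
/-- `H^∞(O; E)`: the space of bounded holomorphic functions `O → E` with the supremum norm. -/
def HInf : Submodule ℂ (O →ᵇ E) where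
  carrier := {g | IsHolomorphic (g : O → E)}
  zero_mem' := by
    intro a
    have h : zeroExt (((0 : O →ᵇ E)) : O → E) = 0 := by
      have := zeroExt_smul (0 : ℂ) (((0 : O →ᵇ E)) : O → E)
      simpa using this
    rw [h]
    exact differentiableAt_const 0
  add_mem' := by
    intro g₁ g₂ h₁ h₂ a
    rw [BoundedContinuousFunction.coe_add, zeroExt_add]
    exact (h₁ a).add (h₂ a)
  smul_mem' := by
    intro c g hg a
    rw [BoundedContinuousFunction.coe_smul]
    exact (zeroExt_smul c (g : O → E)) ▸ (hg a).const_smul c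

instance : CoeFun (HInf O E) (fun _ => O → E) := ⟨fun g => (g : O →ᵇ E)⟩

/-- A bounded holomorphic function as an element of `H^∞(O; E)`. -/
def HInf.ofBounded (g : O → E) (hg : IsHolomorphic g) (hb : ∃ C : ℝ, ∀ z, ‖g z‖ ≤ C) :
    HInf O E :=
  ⟨BoundedContinuousFunction.ofNormedAddCommGroup g hg.continuous hb.choose hb.choose_spec, hg⟩

/-- Bounded pointwise convergence of a sequence in `H^∞(O; E)`. -/
def BPTendsto (g : ℕ → HInf O E) (g₀ : HInf O E) : Prop :=
  (∀ z : O, Tendsto (fun n => g n z) atTop (𝓝 (g₀ z))) ∧ ∃ C : ℝ, ∀ n, ‖g n‖ ≤ C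

/-- A linear functional on `H^∞(O)` is bp-continuous if it maps bp-convergent sequences to
convergent sequences, with the expected limits. -/
def IsBPContinuous (φ : HInf O ℂ →ₗ[ℂ] ℂ) : Prop :=
  ∀ (g : ℕ → HInf O ℂ) (g₀ : HInf O ℂ), BPTendsto g g₀ →
    Tendsto (fun n => φ (g n)) atTop (𝓝 (φ g₀))

theorem IsBPContinuous.continuous {φ : HInf O ℂ →ₗ[ℂ] ℂ} (hφ : IsBPContinuous φ) :
    Continuous φ := by
  rw [continuous_iff_seqContinuous]
  intro g g₀ hg
  refine hφ g g₀ ⟨fun z => ?_, ?_⟩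
  · have h : Tendsto (fun n => (g n : O →ᵇ ℂ)) atTop (𝓝 (g₀ : O →ᵇ ℂ)) :=
      (continuous_subtype_val.tendsto g₀).comp hg
    exact ((BoundedContinuousFunction.lipschitz_eval_const z).continuous.tendsto _).comp h
  · obtain ⟨C, hC⟩ := hg.norm.bddAbove_range
    exact ⟨C, fun n => hC ⟨n, rfl⟩⟩

/-- A bp-continuous linear functional as an element of the Banach space dual of `H^∞(O)`; its norm
is the usual operator norm. -/
def IsBPContinuous.toDual {φ : HInf O ℂ →ₗ[ℂ] ℂ} (hφ : IsBPContinuous φ) : HInf O ℂ →L[ℂ] ℂ :=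
  ⟨φ, hφ.continuous⟩

end HolFubini

end

/-!
The functionals on `H^∞(O)` that occur here all lie in the closed span `Predual O` of the point
evaluations `δ_z` in the dual of `H^∞(O)`, and the map `δ : z ↦ δ_z` into this Banach space is
holomorphic (`isHolomorphic_delta`, by the Schwarz lemma). Everything is reduced to one bounded
operator `T : Predual O → L^p`, `T ψ = [t ↦ ψ(f_t)]` (`transfer`):

* `F = T ∘ δ` is holomorphic as the composition of a bounded operator with a holomorphic map, and
  iterated partial derivatives commute with `T` and with evaluation at each `f_t`, both being
  continuous linear maps (`multiDeriv_clm_comp`). This gives `D^α F(a) = D^α_z f(a, ·)`.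
* Pairing with `h ∈ L^q` gives a functional `L` on `Predual O`. Its composition with `δ` is
  `z ↦ ∫ f(z, t) h(t) dt`, so differentiation under the integral is the same statement for `L`.
  Moreover `ψ(L ∘ δ) = L ψ` for all `ψ`, since both sides are continuous in `ψ` and agree at each
  `δ_z` (`exists_bddHol_of_clm`).
* A bp-continuous functional belongs to `Predual O` (`IsBPContinuous.toStrongDual_mem`). Thus
  `t ↦ φ(f_t)` is a pointwise limit of linear combinations of the measurable functions `f(z, ·)`,
  and `T φ` lies in the closed span of the values `T δ_z = F(z)`.

The remaining point is that `T` is bounded, with norm at most `sup_z ‖f(z, ·)‖_p`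
(`eLpNorm_predual_apply_le`). If it is bounded at all, then for a norming functional `ℓ` of `T ψ`
the function `G = ℓ ∘ T ∘ δ` is bounded by this supremum, and `‖T ψ‖ = |ψ(G)|`. Boundedness is
trivial if `f_t` is uniformly bounded in `t` and vanishes outside a set of finite measure. The
general case follows by exhausting `Ω` with such sets and Fatou's lemma. No assumption of
σ-finiteness is needed, because a family with values in `L^p`, `p < ∞`, that is continuous in `z`
vanishes outside a σ-finite set.
-/

namespace HolFubini

open Metric Set

/-! ### Consequences of the Schwarz lemma -/

theorem mapsTo_closedBall_of_norm_le {V E : Type*} [SeminormedAddCommGroup V]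
    [SeminormedAddCommGroup E] {g : V → E} {c : V} {R M : ℝ} (hM : ∀ z ∈ ball c R, ‖g z‖ ≤ M)
    (hR : 0 < R) :
    MapsTo g (ball c R) (closedBall (g c) (2 * M)) := by
  intro z hz
  rw [mem_closedBall, dist_eq_norm]
  linarith [norm_sub_le (g z) (g c), hM z hz, hM c (mem_ball_self hR)]

section Schwarz

variable {V E : Type*} [NormedAddCommGroup V] [NormedSpace ℂ V] [NormedAddCommGroup E]
  [NormedSpace ℂ E] {g : V → E} {c z : V} {R M : ℝ}

theorem norm_sub_le_of_norm_le (hd : DifferentiableOn ℂ g (ball c R))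
    (hM : ∀ z ∈ ball c R, ‖g z‖ ≤ M) (hz : z ∈ ball c R) :
    ‖g z - g c‖ ≤ 2 * M / R * ‖z - c‖ := by
  have hR : 0 < R := nonempty_ball.mp ⟨_, hz⟩
  simpa [dist_eq_norm] using Complex.dist_le_div_mul_dist_of_mapsTo_ball hd
    (mapsTo_closedBall_of_norm_le hM hR) hz

theorem norm_fderiv_le_of_norm_le (hd : DifferentiableOn ℂ g (ball c R))
    (hM : ∀ z ∈ ball c R, ‖g z‖ ≤ M) (hR : 0 < R) : ‖fderiv ℂ g c‖ ≤ 2 * M / R :=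
  Complex.norm_fderiv_le_div_of_mapsTo_ball hd (mapsTo_closedBall_of_norm_le hM hR) hR

/-- The second-order Schwarz estimate: the first-order Taylor remainder of a bounded holomorphic
function is quadratic, with a constant that depends only on the bound and the radius. -/
theorem norm_taylor_remainder_le (hd : DifferentiableOn ℂ g (ball c R))
    (hM : ∀ z ∈ ball c R, ‖g z‖ ≤ M) (hz : z ∈ ball c R) :
    ‖g z - g c - fderiv ℂ g c (z - c)‖ ≤ 4 * M * (‖z - c‖ / R) ^ 2 := by
  have hR : 0 < R := nonempty_ball.mp ⟨_, hz⟩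
  have hdc : DifferentiableAt ℂ g c := hd.differentiableAt (ball_mem_nhds c hR)
  set w : V → E := fun z => g z - g c - fderiv ℂ g c (z - c) with hw
  have hwc : w c = 0 := by simp [hw]
  have hwd : DifferentiableOn ℂ w (ball c R) := by
    refine (hd.sub_const _).sub ?_
    exact ((fderiv ℂ g c).differentiable.comp (differentiable_id.sub_const c)).differentiableOn
  have hmaps : MapsTo w (ball c R) (closedBall (w c) (4 * M)) := by
    intro y hy
    rw [hwc, mem_closedBall_zero_iff]
    have h1 : ‖g y - g c‖ ≤ 2 * M := by
      simpa [dist_eq_norm] using mapsTo_closedBall_of_norm_le hM hR hy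
    have h2 : ‖fderiv ℂ g c (y - c)‖ ≤ 2 * M := by
      refine ((fderiv ℂ g c).le_opNorm _).trans ?_
      have h3 := norm_fderiv_le_of_norm_le hd hM hR
      have h4 : ‖y - c‖ ≤ R := by simpa [dist_eq_norm] using (mem_ball.1 hy).le
      calc ‖fderiv ℂ g c‖ * ‖y - c‖ ≤ 2 * M / R * R :=
            mul_le_mul h3 h4 (norm_nonneg _) ((norm_nonneg _).trans h3)
        _ = 2 * M := by field_simp
    linarith [norm_sub_le (g y - g c) (fderiv ℂ g c (y - c))]
  have ho : (fun y => w y - w c) =o[𝓝 c] fun y => ‖y - c‖ ^ 1 := by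
    simp only [hwc, sub_zero, pow_one]
    exact (hasFDerivAt_iff_isLittleO.1 hdc.hasFDerivAt).norm_right
  have := Complex.dist_le_mul_div_pow_of_mapsTo_ball_of_isLittleO hwd hmaps ho hz
  rw [hwc, dist_zero_right, dist_eq_norm] at this
  simpa only [one_add_one_eq_two] using this

/-- Locally uniform limits of holomorphic functions are holomorphic, for functions on a normed
space: by the Schwarz lemma the derivatives form a uniform Cauchy sequence. -/
theorem differentiableAt_of_tendstoUniformlyOn [CompleteSpace E] {u : ℕ → V → E} (hR : 0 < R)
    (hu : ∀ n, DifferentiableOn ℂ (u n) (ball c R))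
    (hg : TendstoUniformlyOn u g atTop (ball c R)) : DifferentiableAt ℂ g c := by
  have hR2 : 0 < R / 2 := by positivity
  have hsub : ball c (R / 2) ⊆ ball c R := ball_subset_ball (by linarith)
  have hda : ∀ n, ∀ x ∈ ball c R, DifferentiableAt ℂ (u n) x := fun n x hx =>
    (hu n).differentiableAt (isOpen_ball.mem_nhds hx)
  have hC : UniformCauchySeqOn (fun n => fderiv ℂ (u n)) atTop (ball c (R / 2)) := by
    rw [Metric.uniformCauchySeqOn_iff]
    intro ε hε
    obtain ⟨N, hN⟩ := Metric.uniformCauchySeqOn_iff.1 hg.uniformCauchySeqOn (ε * R / 8)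
      (by positivity)
    refine ⟨N, fun m hm n hn x hx => ?_⟩
    have hxsub : ball x (R / 2) ⊆ ball c R := by
      intro y hy
      rw [mem_ball] at *
      linarith [dist_triangle y x c]
    have := norm_fderiv_le_of_norm_le (g := fun y => u m y - u n y) (M := ε * R / 8)
      (((hu m).sub (hu n)).mono hxsub)
      (fun y hy => by simpa [dist_eq_norm] using (hN m hm n hn y (hxsub hy)).le) hR2
    rw [fderiv_fun_sub (hda m x (hsub hx)) (hda n x (hsub hx))] at this
    rw [dist_eq_norm]
    refine this.trans_lt ?_
    rw [show 2 * (ε * R / 8) / (R / 2) = ε / 2 by field_simp; norm_num]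
    linarith
  have hlim : ∀ x ∈ ball c (R / 2), ∃ l, Tendsto (fun n => fderiv ℂ (u n) x) atTop (𝓝 l) :=
    fun x hx => cauchySeq_tendsto_of_complete (hC.cauchySeq hx)
  choose! g' hg' using hlim
  exact (hasFDerivAt_of_tendstoUniformlyOn isOpen_ball
    (hC.tendstoUniformlyOn_of_tendsto hg')
    (fun n x hx => (hda n x (hsub hx)).hasFDerivAt)
    (fun x hx => hg.tendsto_at (hsub hx)) (mem_ball_self hR2)).differentiableAt

/-- Directional derivatives of holomorphic functions are holomorphic: they are locally uniform
limits of difference quotients. -/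
theorem differentiableOn_lineDeriv [CompleteSpace E] {U : Set V} (hU : IsOpen U)
    (hg : DifferentiableOn ℂ g U) (v : V) :
    DifferentiableOn ℂ (fun z => lineDeriv ℂ g z v) U := by
  intro a ha
  refine DifferentiableAt.differentiableWithinAt ?_
  have hca : ContinuousAt g a := (hg.differentiableAt (hU.mem_nhds ha)).continuousAt
  obtain ⟨ρ, hρ, hball⟩ := Metric.mem_nhds_iff.1 (inter_mem (hU.mem_nhds ha)
    (hca.norm.eventually (gt_mem_nhds (lt_add_one ‖g a‖))))
  set M := ‖g a‖ + 1
  set r := ρ / 2 with hr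
  have hr0 : 0 < r := by positivity
  have hsub : ∀ z ∈ ball a r, ball z r ⊆ U ∩ {x | ‖g x‖ < M} := fun z hz y hy => by
    refine hball ?_
    rw [mem_ball] at *
    linarith [dist_triangle y z a]
  have hsU : ball a r ⊆ U := fun z hz => (hsub z hz (mem_ball_self hr0)).1
  -- The factor `r / (‖v‖ + 1)` keeps `z + s n • v` within distance `r` of `z` for every `n`.
  set s : ℕ → ℝ := fun n => r / (‖v‖ + 1) * (1 / ((n : ℝ) + 1)) with hs
  have hs0 : ∀ n, 0 < s n := fun n => by positivity
  have hsv : ∀ n, ‖((s n : ℂ) • v)‖ < r := fun n => by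
    rw [norm_smul, Complex.norm_real, Real.norm_of_nonneg (hs0 n).le]
    have h1 : s n ≤ r / (‖v‖ + 1) := by
      refine mul_le_of_le_one_right (by positivity) ?_
      rw [div_le_one (by positivity)]
      linarith [(Nat.cast_nonneg n : (0 : ℝ) ≤ n)]
    calc s n * ‖v‖ ≤ r / (‖v‖ + 1) * ‖v‖ := by gcongr
      _ < r / (‖v‖ + 1) * (‖v‖ + 1) := by gcongr; linarith
      _ = r := by field_simp
  have hstend : Tendsto s atTop (𝓝 0) := by
    simpa only [hs, mul_zero] using
      (tendsto_one_div_add_atTop_nhds_zero_nat (𝕜 := ℝ)).const_mul (r / (‖v‖ + 1))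
  refine differentiableAt_of_tendstoUniformlyOn (R := r)
    (u := fun n z => (s n : ℂ)⁻¹ • (g (z + (s n : ℂ) • v) - g z)) hr0 (fun n => ?_) ?_
  · refine DifferentiableOn.const_smul (DifferentiableOn.sub ?_ (hg.mono hsU)) _
    refine hg.comp (differentiable_id.add_const _).differentiableOn fun z hz => ?_
    refine (hsub z hz ?_).1
    simpa [dist_eq_norm] using hsv n
  · rw [Metric.tendstoUniformlyOn_iff]
    intro ε hε
    have hK : Tendsto (fun n => s n * (4 * M * ‖v‖ ^ 2 / r ^ 2)) atTop (𝓝 0) := by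
      simpa using hstend.mul_const (4 * M * ‖v‖ ^ 2 / r ^ 2)
    filter_upwards [hK.eventually (gt_mem_nhds hε)] with n hn z hz
    have hrem := norm_taylor_remainder_le (z := z + (s n : ℂ) • v)
      (hg.mono fun y hy => (hsub z hz hy).1) (fun y hy => (hsub z hz hy).2.le)
      (by simpa [dist_eq_norm] using hsv n)
    have hsc : (s n : ℂ) ≠ 0 := by exact_mod_cast (hs0 n).ne'
    rw [(hg.differentiableAt (hU.mem_nhds (hsU hz))).lineDeriv_eq_fderiv, dist_comm,
      dist_eq_norm]
    have heq : (s n : ℂ)⁻¹ • (g (z + (s n : ℂ) • v) - g z) - fderiv ℂ g z v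
        = (s n : ℂ)⁻¹ • (g (z + (s n : ℂ) • v) - g z - fderiv ℂ g z (z + (s n : ℂ) • v - z)) := by
      rw [add_sub_cancel_left, map_smul, smul_sub _ _ ((s n : ℂ) • _), inv_smul_smul₀ hsc]
    rw [heq, norm_smul, norm_inv, Complex.norm_real, Real.norm_of_nonneg (hs0 n).le]
    refine lt_of_le_of_lt ?_ hn
    rw [inv_mul_le_iff₀ (hs0 n)]
    refine hrem.trans_eq ?_
    rw [add_sub_cancel_left, norm_smul, Complex.norm_real, Real.norm_of_nonneg (hs0 n).le]
    ring

end Schwarz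

/-! ### Iterated partial derivatives -/

section MultiDeriv

variable {d : ℕ} {O : TopologicalSpace.Opens (Fin d → ℂ)}
  {E : Type*} [NormedAddCommGroup E] [NormedSpace ℂ E]
  {E' : Type*} [NormedAddCommGroup E'] [NormedSpace ℂ E']

theorem isHolomorphic_iff_differentiableOn {g : O → E} :
    IsHolomorphic g ↔ DifferentiableOn ℂ (zeroExt g) O :=
  ⟨fun h a ha => (h ⟨a, ha⟩).differentiableWithinAt,
    fun h a => h.differentiableAt (O.isOpen.mem_nhds a.2)⟩

theorem zeroExt_comp (L : E →L[ℂ] E') (g : O → E) :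
    zeroExt (fun z => L (g z)) = fun z => L (zeroExt g z) := by
  funext z
  by_cases hz : z ∈ O
  · exact (zeroExt_apply (fun z => L (g z)) ⟨z, hz⟩).trans
      (congrArg L (zeroExt_apply g ⟨z, hz⟩).symm)
  · simp [zeroExt_of_notMem _ hz]

theorem IsHolomorphic.clm_comp {g : O → E} (hg : IsHolomorphic g) (L : E →L[ℂ] E') :
    IsHolomorphic (fun z => L (g z)) := by
  intro a
  rw [zeroExt_comp]
  exact L.differentiableAt.comp _ (hg a)

theorem partialDeriv_clm_comp (L : E →L[ℂ] E') {u : (Fin d → ℂ) → E'} {w : (Fin d → ℂ) → E}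
    (hw : DifferentiableOn ℂ w O) (huw : EqOn u (fun z => L (w z)) O) (j : Fin d) :
    EqOn (partialDeriv j u) (fun z => L (partialDeriv j w z)) O := by
  intro z hz
  have h1 : u =ᶠ[𝓝 z] fun z => L (w z) := huw.eventuallyEq_of_mem (O.isOpen.mem_nhds hz)
  have h2 := (hw.differentiableAt (O.isOpen.mem_nhds hz)).hasFDerivAt
  have h3 : HasFDerivAt (fun z => L (w z)) (L ∘L fderiv ℂ w z) z := L.hasFDerivAt.comp z h2
  simp only [partialDeriv]
  rw [h1.lineDeriv_eq, (h3.hasLineDerivAt _).lineDeriv, (h2.hasLineDerivAt _).lineDeriv]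
  rfl

/-- Iterated partial derivatives of holomorphic functions commute with continuous linear maps. -/
theorem multiDeriv_clm_comp [CompleteSpace E] (L : E →L[ℂ] E') {g : O → E}
    (hg : IsHolomorphic g) (α : Fin d → ℕ) (a : O) :
    multiDeriv α (fun z => L (g z)) a = L (multiDeriv α g a) := by
  -- Holomorphy is carried along, since each further derivative needs differentiability on `O`.
  let Q : ((Fin d → ℂ) → E') → ((Fin d → ℂ) → E) → Prop := fun u w =>
    DifferentiableOn ℂ w O ∧ EqOn u (fun z => L (w z)) O
  have step : ∀ (j : Fin d) u w, Q u w → Q (partialDeriv j u) (partialDeriv j w) :=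
    fun j u w h => ⟨differentiableOn_lineDeriv O.isOpen h.1 _, partialDeriv_clm_comp L h.1 h.2 j⟩
  have iter : ∀ (j : Fin d) (n : ℕ) u w, Q u w →
      Q ((partialDeriv j)^[n] u) ((partialDeriv j)^[n] w) := by
    intro j n
    induction n with
    | zero => exact fun u w h => h
    | succ n ih => exact fun u w h => ih _ _ (step j u w h)
  have fold : ∀ l : List (Fin d),
      Q (l.foldr (fun j u => (partialDeriv j)^[α j] u) (zeroExt fun z => L (g z)))
        (l.foldr (fun j u => (partialDeriv j)^[α j] u) (zeroExt g)) := by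
    intro l
    induction l with
    | nil =>
      refine ⟨isHolomorphic_iff_differentiableOn.1 hg, fun z _ => ?_⟩
      simp only [List.foldr_nil, zeroExt_comp]
    | cons j l ih => exact iter j _ _ _ ih
  exact (fold (List.finRange d)).2 a.2

end MultiDeriv

/-! ### Point evaluations and the bp-continuous functionals -/

variable {d : ℕ} {O : TopologicalSpace.Opens (Fin d → ℂ)}

/-- A map into a closed subspace is differentiable as soon as it is so in the ambient space: its
derivative is a limit of difference quotients, hence takes its values in the subspace. -/
theorem differentiableAt_of_coe {V X : Type*} [NormedAddCommGroup V] [NormedSpace ℂ V]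
    [NormedAddCommGroup X] [NormedSpace ℂ X] {p : Submodule ℂ X} (hp : IsClosed (p : Set X))
    {u : V → p} {a : V} (h : DifferentiableAt ℂ (fun z => (u z : X)) a) :
    DifferentiableAt ℂ u a := by
  have hfd := h.hasFDerivAt
  set A := fderiv ℂ (fun z => (u z : X)) a
  have hmem : ∀ v, A v ∈ p := fun v => by
    have h1 : HasDerivAt _ _ (0 : ℂ) := hfd.hasLineDerivAt v
    refine hp.mem_of_tendsto (hasDerivAt_iff_tendsto_slope.1 h1) (Eventually.of_forall fun s => ?_)
    rw [slope_def_module]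
    exact p.smul_mem _ (p.sub_mem (Subtype.mem _) (Subtype.mem _))
  have hA : HasFDerivAt u (A.codRestrict p hmem) a := by
    rw [hasFDerivAt_iff_isLittleO] at hfd ⊢
    exact Asymptotics.IsLittleO.of_norm_left hfd.norm_left
  exact hA.differentiableAt

variable (O) in
/-- The Banach space `H^∞(O)`, as a type synonym of `HInf O ℂ` that remembers only the normed space
structure. Hiding the construction as a space of bounded continuous functions keeps instance
search on the dual space from unfolding it. -/
def BddHol : Type := HInf O ℂ

noncomputable instance : NormedAddCommGroup (BddHol O) :=
  inferInstanceAs (NormedAddCommGroup (HInf O ℂ))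

noncomputable instance : NormedSpace ℂ (BddHol O) := inferInstanceAs (NormedSpace ℂ (HInf O ℂ))

noncomputable instance : CoeFun (BddHol O) (fun _ => O → ℂ) := ⟨fun g => (g.1 : O →ᵇ ℂ)⟩

theorem BddHol.isHolomorphic (g : BddHol O) : IsHolomorphic (g : O → ℂ) :=
  g.2

theorem BddHol.norm_apply_le (g : BddHol O) (z : O) : ‖g z‖ ≤ ‖g‖ :=
  (g.1 : O →ᵇ ℂ).norm_coe_le_norm z

theorem BddHol.norm_zeroExt_le (g : BddHol O) (z : Fin d → ℂ) : ‖zeroExt g z‖ ≤ ‖g‖ := by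
  by_cases hz : z ∈ O
  · exact (congrArg norm (zeroExt_apply (g : O → ℂ) ⟨z, hz⟩)).trans_le (g.norm_apply_le _)
  · rw [zeroExt_of_notMem _ hz, norm_zero]
    exact norm_nonneg _

theorem BddHol.differentiableOn_zeroExt (g : BddHol O) : DifferentiableOn ℂ (zeroExt g) O :=
  isHolomorphic_iff_differentiableOn.1 g.isHolomorphic

/-- Evaluation at a point of `O`, as a bounded functional on `H^∞(O)`. -/
noncomputable def pointEval (z : O) : StrongDual ℂ (BddHol O) :=
  (BoundedContinuousFunction.evalCLM ℂ z).comp (HInf O ℂ).subtypeL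

@[simp] theorem pointEval_apply (z : O) (g : BddHol O) : pointEval z g = g z := rfl

variable (O) in
/-- The closed linear span of the point evaluations in the dual of `H^∞(O)`. By
`IsBPContinuous.toStrongDual_mem` it contains all bp-continuous functionals. -/
noncomputable def pointEvalSpan : Submodule ℂ (StrongDual ℂ (BddHol O)) :=
  (Submodule.span ℂ (range pointEval)).topologicalClosure

theorem isClosed_pointEvalSpan :
    IsClosed (pointEvalSpan O : Set (StrongDual ℂ (BddHol O))) :=
  Submodule.isClosed_topologicalClosure _

theorem pointEval_mem_pointEvalSpan (z : O) : pointEval z ∈ pointEvalSpan O :=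
  Submodule.le_topologicalClosure _ (Submodule.subset_span ⟨z, rfl⟩)

variable (O) in
/-- The predual of `H^∞(O)`: the Banach space `pointEvalSpan O`, as a type synonym that remembers
only the normed space structure. -/
def Predual : Type := pointEvalSpan O

noncomputable instance : NormedAddCommGroup (Predual O) :=
  inferInstanceAs (NormedAddCommGroup (pointEvalSpan O))

noncomputable instance : NormedSpace ℂ (Predual O) :=
  inferInstanceAs (NormedSpace ℂ (pointEvalSpan O))

instance : CompleteSpace (Predual O) :=
  (isClosed_pointEvalSpan (O := O)).completeSpace_coe

/-- The inclusion of the predual into the dual of `H^∞(O)`. -/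
noncomputable def Predual.toDual : Predual O →L[ℂ] StrongDual ℂ (BddHol O) :=
  (pointEvalSpan O).subtypeL

theorem Predual.norm_toDual (ψ : Predual O) : ‖Predual.toDual ψ‖ = ‖ψ‖ := rfl

theorem Predual.toDual_mem (ψ : Predual O) : Predual.toDual ψ ∈ pointEvalSpan O := ψ.2

/-- The universal bounded holomorphic function `z ↦ δ_z` on `O`, with values in the predual. -/
noncomputable def delta (z : O) : Predual O := ⟨pointEval z, pointEval_mem_pointEvalSpan z⟩

@[simp] theorem toDual_delta (z : O) : Predual.toDual (delta z) = pointEval z := rfl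

theorem norm_delta_le (z : O) : ‖delta z‖ ≤ 1 :=
  ContinuousLinearMap.opNorm_le_bound _ zero_le_one fun g => by
    rw [one_mul]
    exact g.norm_apply_le z

theorem dense_span_delta : Dense (Submodule.span ℂ (range (delta (O := O))) : Set (Predual O)) := by
  have hiso : Isometry (Predual.toDual (O := O)) :=
    AddMonoidHomClass.isometry_of_norm _ Predual.norm_toDual
  have h : Predual.toDual '' (Submodule.span ℂ (range (delta (O := O))) : Set (Predual O))
      = (Submodule.span ℂ (range (pointEval (O := O))) : Set (StrongDual ℂ (BddHol O))) := by
    have := Submodule.map_span (Predual.toDual (O := O)).toLinearMap (range delta)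
    have h2 : (Predual.toDual (O := O)) '' range delta = range pointEval := by
      rw [← range_comp]
      rfl
    exact (congrArg SetLike.coe this).trans
      (congrArg (fun s => (Submodule.span ℂ s : Set (StrongDual ℂ (BddHol O)))) h2)
  intro ψ
  rw [hiso.isUniformInducing.isInducing.closure_eq_preimage_closure_image, h]
  exact ψ.toDual_mem

theorem Predual.clm_ext {X : Type*} [TopologicalSpace X] [AddCommMonoid X] [Module ℂ X] [T2Space X]
    {A B : Predual O →L[ℂ] X} (h : ∀ z, A (delta z) = B (delta z)) : A = B :=
  ContinuousLinearMap.ext_on dense_span_delta (by rintro _ ⟨z, rfl⟩; exact h z)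

/-- The derivative of `z ↦ δ_z` at `a`: in direction `v` it is `g ↦ Dg(a)v`. -/
noncomputable def pointDeriv (a : O) {r : ℝ} (hr : 0 < r) (hball : ball (a : Fin d → ℂ) r ⊆ O) :
    (Fin d → ℂ) →L[ℂ] StrongDual ℂ (BddHol O) :=
  LinearMap.mkContinuous₂
    (LinearMap.mk₂ ℂ (fun v (g : BddHol O) => fderiv ℂ (zeroExt g) a v)
      (fun v w g => map_add _ v w) (fun c v g => map_smul _ c v)
      (fun v g₁ g₂ => by
        change fderiv ℂ (zeroExt ((g₁ : O → ℂ) + (g₂ : O → ℂ))) a v = _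
        rw [zeroExt_add, fderiv_add (g₁.isHolomorphic a) (g₂.isHolomorphic a)]
        rfl)
      (fun c v g => by
        change fderiv ℂ (zeroExt (c • (g : O → ℂ))) a v = _
        rw [zeroExt_smul, fderiv_const_smul (g.isHolomorphic a)]
        rfl))
    (2 / r) fun v g => by
      have h := norm_fderiv_le_of_norm_le (g.differentiableOn_zeroExt.mono hball)
        (fun z _ => g.norm_zeroExt_le z) hr
      calc ‖fderiv ℂ (zeroExt g) a v‖ ≤ ‖fderiv ℂ (zeroExt g) a‖ * ‖v‖ :=
            ContinuousLinearMap.le_opNorm _ _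
        _ ≤ 2 * ‖g‖ / r * ‖v‖ := by gcongr
        _ = 2 / r * ‖v‖ * ‖g‖ := by ring

theorem norm_pointEval_sub_sub_pointDeriv_le (a z : O) {r : ℝ} (hr : 0 < r)
    (hball : ball (a : Fin d → ℂ) r ⊆ O) (hz : (z : Fin d → ℂ) ∈ ball (a : Fin d → ℂ) r) :
    ‖pointEval z - pointEval a - pointDeriv a hr hball (z - a)‖
      ≤ 4 / r ^ 2 * ‖(z : Fin d → ℂ) - a‖ ^ 2 := by
  refine ContinuousLinearMap.opNorm_le_bound _ (by positivity) fun g => ?_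
  have h := norm_taylor_remainder_le (g.differentiableOn_zeroExt.mono hball)
    (fun z _ => g.norm_zeroExt_le z) hz
  rw [zeroExt_apply, zeroExt_apply] at h
  calc _ ≤ 4 * ‖g‖ * (‖(z : Fin d → ℂ) - a‖ / r) ^ 2 := h
    _ = 4 / r ^ 2 * ‖(z : Fin d → ℂ) - a‖ ^ 2 * ‖g‖ := by ring

/-- The Taylor remainder of `δ` at `a` is a functional whose value at `g` is the Taylor remainder of
`g`, so the Schwarz estimates, uniform over the unit ball of `H^∞(O)`, bound its norm. -/
theorem isHolomorphic_delta : IsHolomorphic (delta (O := O)) := by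
  intro a
  obtain ⟨r, hr, hball⟩ := Metric.isOpen_iff.1 O.isOpen a a.2
  have hrem : ∀ z ∈ ball (a : Fin d → ℂ) r,
      ‖Predual.toDual (zeroExt delta z) - Predual.toDual (zeroExt delta a)
        - pointDeriv a hr hball (z - a)‖ ≤ 4 / r ^ 2 * ‖z - (a : Fin d → ℂ)‖ ^ 2 := fun z hz => by
    have h1 : zeroExt delta z = delta ⟨z, hball hz⟩ := zeroExt_apply delta ⟨z, hball hz⟩
    rw [h1, zeroExt_apply]
    exact norm_pointEval_sub_sub_pointDeriv_le a ⟨z, hball hz⟩ hr hball hz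
  have hfd : HasFDerivAt (fun z => Predual.toDual (zeroExt delta z))
      (pointDeriv a hr hball) a := by
    refine .of_isLittleO ?_
    refine Asymptotics.IsBigO.trans_isLittleO (g := fun z => ‖z - (a : Fin d → ℂ)‖ ^ 2) ?_ ?_
    · refine Asymptotics.IsBigO.of_bound (4 / r ^ 2) ?_
      filter_upwards [ball_mem_nhds _ hr] with z hz
      simpa using hrem z hz
    · have : Tendsto (fun z => ‖z - (a : Fin d → ℂ)‖) (𝓝 (a : Fin d → ℂ)) (𝓝 0) := by
        simpa using tendsto_norm_sub_self (a : Fin d → ℂ)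
      have h2 := (Asymptotics.isLittleO_one_iff ℝ).2 this
      simpa [pow_two] using
        h2.mul_isBigO (Asymptotics.isBigO_refl (fun z => ‖z - (a : Fin d → ℂ)‖) _)
  exact differentiableAt_of_coe isClosed_pointEvalSpan hfd.differentiableAt

/-- On a bounded family of holomorphic functions, eventual vanishing at each point of a dense
sequence implies pointwise convergence to zero, since the family is locally equi-Lipschitz. -/
theorem bpTendsto_zero_of_dense {x : ℕ → O} (hx : DenseRange x) {g : ℕ → BddHol O}
    (hg : ∀ n, ‖g n‖ ≤ 1) (h0 : ∀ k n, k < n → g n (x k) = 0) : BPTendsto (O := O) g 0 := by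
  refine ⟨fun z => ?_, 1, hg⟩
  obtain ⟨r, hr, hball⟩ := Metric.isOpen_iff.1 O.isOpen z z.2
  change Tendsto (fun n => g n z) atTop (𝓝 0)
  rw [Metric.tendsto_atTop]
  intro ε hε
  obtain ⟨k, hk⟩ := hx.exists_dist_lt z (ε := min r (ε * r / 4)) (by positivity)
  have hkr : (x k : Fin d → ℂ) ∈ ball (z : Fin d → ℂ) r := by
    rw [mem_ball, dist_comm]
    exact hk.trans_le (min_le_left _ _)
  have hkε : ‖(x k : Fin d → ℂ) - z‖ < ε * r / 4 := by
    rw [← dist_eq_norm, dist_comm]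
    exact hk.trans_le (min_le_right _ _)
  refine ⟨k + 1, fun n hn => ?_⟩
  have h := norm_sub_le_of_norm_le ((g n).differentiableOn_zeroExt.mono hball)
    (fun y _ => ((g n).norm_zeroExt_le y).trans (hg n)) hkr
  rw [zeroExt_apply, zeroExt_apply, h0 k n hn, zero_sub, norm_neg] at h
  rw [dist_zero_right]
  calc ‖g n z‖ ≤ 2 * 1 / r * ‖(x k : Fin d → ℂ) - z‖ := h
    _ ≤ 2 * 1 / r * (ε * r / 4) := by gcongr
    _ = ε / 2 := by field_simp; norm_num
    _ < ε := by linarith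

/-- A bp-continuous functional, as an element of the dual of `BddHol O`. -/
noncomputable def IsBPContinuous.toStrongDual {φ : HInf O ℂ →ₗ[ℂ] ℂ} (hφ : IsBPContinuous φ) :
    StrongDual ℂ (BddHol O) :=
  hφ.toDual

/-- A bp-continuous functional is a norm limit of linear combinations of point evaluations. By the
Hahn-Banach theorem its distance to the span of `δ_{x 0}, …, δ_{x (n-1)}` is at most the norm of its
restriction to the functions vanishing at these points; for a dense sequence `x` these norms tend to
zero by bp-continuity. -/
theorem IsBPContinuous.toStrongDual_mem {φ : HInf O ℂ →ₗ[ℂ] ℂ} (hφ : IsBPContinuous φ) :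
    hφ.toStrongDual ∈ pointEvalSpan O := by
  rcases isEmpty_or_nonempty O with hO | hO
  · have : hφ.toStrongDual = 0 := by
      ext g
      have hg : g = 0 := Subtype.ext (BoundedContinuousFunction.ext fun z => hO.elim z)
      rw [hg, map_zero, map_zero]
    rw [this]
    exact Submodule.zero_mem _
  set x : ℕ → O := TopologicalSpace.denseSeq O
  have hx : DenseRange x := TopologicalSpace.denseRange_denseSeq O
  let N : ℕ → Submodule ℂ (BddHol O) := fun n =>
    ⨅ k : Fin n, LinearMap.ker (pointEval (x k) : BddHol O →ₗ[ℂ] ℂ)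
  have hN : ∀ n g, g ∈ N n ↔ ∀ k : Fin n, g (x k) = 0 := fun n g => by
    simp [N, Submodule.mem_iInf]
  change hφ.toStrongDual ∈ closure _
  rw [Metric.mem_closure_iff]
  intro ε hε
  obtain ⟨n, hn⟩ : ∃ n, ‖hφ.toStrongDual.comp (N n).subtypeL‖ < ε := by
    by_contra! hcon
    have hex : ∀ n, ∃ g : N n, ‖g‖ < 1 ∧ ε / 2 < ‖hφ.toStrongDual.comp (N n).subtypeL g‖ := fun n =>
      ContinuousLinearMap.exists_lt_apply_of_lt_opNorm _
        ((half_lt_self hε).trans_le (hcon n))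
    choose g hg1 hgε using hex
    have hbp : BPTendsto (O := O) (fun n => (g n : BddHol O)) 0 :=
      bpTendsto_zero_of_dense hx (fun n => (hg1 n).le)
        fun k n hkn => (hN n _).1 (g n).2 ⟨k, hkn⟩
    have ht := (hφ _ _ hbp).norm
    rw [map_zero, norm_zero] at ht
    obtain ⟨n, hn⟩ := (ht.eventually (gt_mem_nhds (half_pos hε))).exists
    exact lt_asymm hn (hgε n)
  obtain ⟨ψ, hψ, hψn⟩ := exists_extension_norm_eq (N n) (hφ.toStrongDual.comp (N n).subtypeL)
  refine ⟨hφ.toStrongDual - ψ, ?_, by rwa [dist_eq_norm, sub_sub_cancel, hψn]⟩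
  have hspan : ((hφ.toStrongDual - ψ : StrongDual ℂ (BddHol O)) : BddHol O →ₗ[ℂ] ℂ) ∈
      Submodule.span ℂ (range fun k : Fin n => (pointEval (x k) : BddHol O →ₗ[ℂ] ℂ)) := by
    refine mem_span_of_iInf_ker_le_ker fun g hg => ?_
    have := hψ ⟨g, hg⟩
    simp only [LinearMap.mem_ker]
    change hφ.toStrongDual g - ψ g = 0
    rw [this]
    exact sub_self _
  obtain ⟨c, hc⟩ := (Submodule.mem_span_range_iff_exists_fun ℂ).1 hspan
  have hsum : hφ.toStrongDual - ψ = ∑ k : Fin n, c k • pointEval (x k) := by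
    refine ContinuousLinearMap.coe_injective ?_
    rw [← hc]
    ext g
    simp
  rw [hsum]
  exact Submodule.sum_mem _ fun k _ => Submodule.smul_mem _ _ (Submodule.subset_span ⟨_, rfl⟩)

/-! ### The predual and duality -/

theorem BddHol.norm_le_iff (g : BddHol O) {C : ℝ} (hC : 0 ≤ C) : ‖g‖ ≤ C ↔ ∀ z, ‖g z‖ ≤ C :=
  BoundedContinuousFunction.norm_le (f := (g.1 : O →ᵇ ℂ)) hC

theorem BddHol.continuous (g : BddHol O) : Continuous (g : O → ℂ) :=
  (g.1 : O →ᵇ ℂ).continuous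

theorem BddHol.norm_le_iff_of_denseRange {x : ℕ → O} (hx : DenseRange x) (g : BddHol O) {C : ℝ}
    (hC : 0 ≤ C) : ‖g‖ ≤ C ↔ ∀ k, ‖g (x k)‖ ≤ C := by
  rw [g.norm_le_iff hC]
  exact ⟨fun h k => h _, fun h z =>
    hx.induction_on z (isClosed_le g.continuous.norm continuous_const) h⟩

theorem BddHol.eq_zero_of_isEmpty [IsEmpty O] (g : BddHol O) : g = 0 :=
  norm_le_zero_iff.1 ((g.norm_le_iff le_rfl).2 isEmptyElim)

/-- `H^∞(O)` is the dual of `Predual O`: a functional `L` on the predual is represented by the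
bounded holomorphic function `z ↦ L δ_z`. -/
theorem exists_bddHol_of_clm (L : Predual O →L[ℂ] ℂ) :
    ∃ G : BddHol O, (∀ z, G z = L (delta z)) ∧
      ∀ ψ : Predual O, Predual.toDual ψ G = L ψ := by
  let G : BddHol O := HInf.ofBounded (fun z => L (delta z)) (isHolomorphic_delta.clm_comp L)
    ⟨‖L‖, fun z => L.unit_le_opNorm _ (norm_delta_le z)⟩
  have hG : ∀ z, G z = L (delta z) := fun z => rfl
  refine ⟨G, hG, fun ψ => ?_⟩
  have : (ContinuousLinearMap.apply ℂ ℂ G).comp Predual.toDual = L :=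
    Predual.clm_ext fun z => hG z
  exact DFunLike.congr_fun this ψ

theorem toDual_multiDeriv_delta (α : Fin d → ℕ) (a : O) (g : BddHol O) :
    Predual.toDual (multiDeriv α delta a) g = multiDeriv α g a :=
  (multiDeriv_clm_comp ((ContinuousLinearMap.apply ℂ ℂ g).comp Predual.toDual)
    isHolomorphic_delta α a).symm

/-! ### The operator induced by a family of bounded holomorphic functions -/

section Transfer

variable {Ω : Type*} [MeasurableSpace Ω] {μ : Measure Ω} {p : ℝ≥0∞} {f : Ω → BddHol O}

theorem measurable_predual_apply (hf : ∀ z, Measurable fun t => f t z) (ψ : Predual O) :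
    Measurable fun t => Predual.toDual ψ (f t) := by
  have hspan : ∀ ξ ∈ Submodule.span ℂ (range (pointEval (O := O))), Measurable fun t => ξ (f t) := by
    intro ξ hξ
    induction hξ using Submodule.span_induction with
    | mem ξ h =>
      obtain ⟨z, rfl⟩ := h
      exact hf z
    | zero => exact measurable_const
    | add ξ η _ _ h₁ h₂ => exact h₁.add h₂
    | smul c ξ _ h => exact h.const_smul c
  obtain ⟨u, hu, hlim⟩ := mem_closure_iff_seq_limit.1 ψ.toDual_mem
  refine measurable_of_tendsto_metrizable (fun n => hspan (u n) (hu n)) ?_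
  rw [tendsto_pi_nhds]
  exact fun t => ((ContinuousLinearMap.apply ℂ ℂ (f t)).continuous.tendsto _).comp hlim

theorem memLp_predual_apply (hf : ∀ z, Measurable fun t => f t z) {C : NNReal}
    (hC : ∀ ψ : Predual O,
      eLpNorm (fun t => Predual.toDual ψ (f t)) p μ ≤ C * ‖ψ‖ₑ) (ψ : Predual O) :
    MemLp (fun t => Predual.toDual ψ (f t)) p μ :=
  ⟨(measurable_predual_apply hf ψ).aestronglyMeasurable,
    (hC ψ).trans_lt (ENNReal.mul_lt_top ENNReal.coe_lt_top enorm_lt_top)⟩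

variable [Fact (1 ≤ p)]

/-- The operator `Predual O → L^p` that maps `ψ` to the class of `t ↦ ψ(f_t)`. -/
noncomputable def transfer (hf : ∀ z, Measurable fun t => f t z) (C : NNReal)
    (hC : ∀ ψ : Predual O,
      eLpNorm (fun t => Predual.toDual ψ (f t)) p μ ≤ C * ‖ψ‖ₑ) :
    Predual O →L[ℂ] Lp ℂ p μ :=
  LinearMap.mkContinuous
    { toFun := fun ψ => (memLp_predual_apply hf hC ψ).toLp _
      map_add' := fun _ _ => rfl
      map_smul' := fun _ _ => rfl } C fun ψ => by
    change ‖(memLp_predual_apply hf hC ψ).toLp _‖ ≤ _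
    rw [Lp.norm_toLp]
    refine ENNReal.toReal_le_of_le_ofReal (by positivity) ((hC ψ).trans_eq ?_)
    rw [ENNReal.ofReal_mul C.coe_nonneg, ofReal_norm, ENNReal.ofReal_coe_nnreal]

theorem transfer_apply (hf : ∀ z, Measurable fun t => f t z) (C : NNReal)
    (hC : ∀ ψ : Predual O,
      eLpNorm (fun t => Predual.toDual ψ (f t)) p μ ≤ C * ‖ψ‖ₑ) (ψ : Predual O) :
    transfer hf C hC ψ = (memLp_predual_apply hf hC ψ).toLp _ := rfl

/-- If the operator induced by `f` is bounded at all, then its norm is at most the supremum of the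
norms of its values at the point evaluations: norm `T ψ` by a functional `ℓ` and apply `ψ` to the
bounded holomorphic function `z ↦ ℓ(T δ_z)`. -/
theorem eLpNorm_predual_apply_le_of_bounded (hf : ∀ z, Measurable fun t => f t z) (C : NNReal)
    (hC : ∀ ψ : Predual O,
      eLpNorm (fun t => Predual.toDual ψ (f t)) p μ ≤ C * ‖ψ‖ₑ)
    {S : NNReal} (hS : ∀ z, eLpNorm (fun t => f t z) p μ ≤ S) (ψ : Predual O) :
    eLpNorm (fun t => Predual.toDual ψ (f t)) p μ ≤ S * ‖ψ‖ₑ := by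
  set T := transfer hf C hC with hT
  have hTδ : ∀ z, ‖T (delta z)‖ ≤ S := fun z => by
    rw [hT, transfer_apply, Lp.norm_toLp]
    exact ENNReal.toReal_le_of_le_ofReal S.coe_nonneg (by simpa using hS z)
  obtain ⟨ℓ, hℓ, hℓT⟩ := exists_dual_vector'' ℂ (T ψ)
  obtain ⟨G, hG, hGψ⟩ := exists_bddHol_of_clm (ℓ.comp T)
  have hGS : ‖G‖ ≤ S := by
    rw [G.norm_le_iff S.coe_nonneg]
    intro z
    rw [hG z]
    calc ‖ℓ (T (delta z))‖ ≤ 1 * ‖T (delta z)‖ := ℓ.le_of_opNorm_le hℓ _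
      _ ≤ S := by simpa using hTδ z
  have hnorm : ‖T ψ‖ ≤ S * ‖ψ‖ := by
    have h1 : ‖T ψ‖ = ‖Predual.toDual ψ G‖ := by
      rw [hGψ ψ, ContinuousLinearMap.comp_apply, hℓT]
      simp
    rw [h1, mul_comm]
    exact (ContinuousLinearMap.le_opNorm _ _).trans
      (mul_le_mul_of_nonneg_left hGS (norm_nonneg _))
  have hMem := memLp_predual_apply hf hC ψ
  rw [hT, transfer_apply, Lp.norm_toLp] at hnorm
  calc _ = ENNReal.ofReal (eLpNorm (fun t => Predual.toDual ψ (f t)) p μ).toReal :=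
        (ENNReal.ofReal_toReal hMem.2.ne).symm
    _ ≤ ENNReal.ofReal (S * ‖ψ‖) := ENNReal.ofReal_le_ofReal hnorm
    _ = S * ‖ψ‖ₑ := by
        rw [ENNReal.ofReal_mul S.coe_nonneg, ofReal_norm, ENNReal.ofReal_coe_nnreal]

/-- The central estimate: `‖ψ(f_·)‖_p ≤ ‖ψ‖ sup_z ‖f_·(z)‖_p` for `ψ` in the predual. The family
`f` is exhausted by its restrictions to sets of finite measure on which it is uniformly bounded;
for these the induced operator is bounded for trivial reasons, and Fatou's lemma applies since the
resulting bound does not depend on the set. -/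
theorem eLpNorm_predual_apply_le (hp : p ≠ ∞) (hf : ∀ z, Measurable fun t => f t z)
    {S : NNReal} (hS : ∀ z, eLpNorm (fun t => f t z) p μ ≤ S) (ψ : Predual O) :
    eLpNorm (fun t => Predual.toDual ψ (f t)) p μ ≤ S * ‖ψ‖ₑ := by
  rcases isEmpty_or_nonempty O with hO | hO
  · have h0 : (fun t => Predual.toDual ψ (f t)) = 0 := by
      funext t
      rw [(f t).eq_zero_of_isEmpty, map_zero, Pi.zero_apply]
    rw [h0, eLpNorm_zero]
    exact zero_le
  have hp0 : p ≠ 0 := (zero_lt_one.trans_le (Fact.out : 1 ≤ p)).ne'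
  set x : ℕ → O := TopologicalSpace.denseSeq O
  have hx : DenseRange x := TopologicalSpace.denseRange_denseSeq O
  -- Outside the union of these sets `f` vanishes; the lower bound makes their measure finite.
  let B : ℕ → Set Ω := fun m =>
    {t | ‖f t‖ ≤ m} ∩ ⋃ k ∈ Finset.range m, {t | 1 / ((m : ℝ) + 1) ≤ ‖f t (x k)‖}
  have hBmeas : ∀ m, MeasurableSet (B m) := fun m => by
    refine MeasurableSet.inter ?_ (Finset.measurableSet_biUnion _ fun k _ =>
      measurableSet_le measurable_const (hf (x k)).norm)
    simp only [BddHol.norm_le_iff_of_denseRange hx _ (Nat.cast_nonneg m), ofPred_forall]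
    exact MeasurableSet.iInter fun k => measurableSet_le (hf (x k)).norm measurable_const
  have hBfin : ∀ m, μ (B m) < ∞ := fun m => by
    refine (measure_mono inter_subset_right).trans_lt
      ((measure_biUnion_finset_le _ _).trans_lt (ENNReal.sum_lt_top.2 fun k _ => ?_))
    have hL : MemLp (fun t => f t (x k)) p μ :=
      ⟨(hf (x k)).aestronglyMeasurable, (hS (x k)).trans_lt ENNReal.coe_lt_top⟩
    have := hL.meas_ge_lt_top (ε := ⟨1 / ((m : ℝ) + 1), by positivity⟩) hp0 hp
      (ne_of_gt (NNReal.coe_pos.1 (by positivity : (0 : ℝ) < 1 / ((m : ℝ) + 1))))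
    exact this
  have hind : ∀ m z, (fun t => (B m).indicator f t z) = (B m).indicator fun t => f t z :=
    fun m z => by
      funext t
      by_cases ht : t ∈ B m
      · simp only [indicator_of_mem ht]
      · simp only [indicator_of_notMem ht]
        rfl
  have hfm : ∀ m z, Measurable fun t => (B m).indicator f t z := fun m z => by
    rw [hind]
    exact (hf z).indicator (hBmeas m)
  have htrunc : ∀ m, eLpNorm (fun t => Predual.toDual ψ ((B m).indicator f t)) p μ
      ≤ S * ‖ψ‖ₑ := fun m => by
    have hμB : μ (B m) ^ (1 / p.toReal) ≠ ∞ :=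
      ENNReal.rpow_ne_top_of_nonneg (by positivity) (hBfin m).ne
    refine eLpNorm_predual_apply_le_of_bounded (hfm m)
      (m * (μ (B m) ^ (1 / p.toReal)).toNNReal) (fun ξ => ?_) (fun z => ?_) ψ
    · calc _ ≤ eLpNorm ((B m).indicator fun _ => (m : ℝ) * ‖ξ‖) p μ := by
            refine eLpNorm_mono fun t => ?_
            by_cases ht : t ∈ B m
            · simp only [indicator_of_mem ht]
              rw [Real.norm_of_nonneg (by positivity), mul_comm]
              exact (ContinuousLinearMap.le_opNorm _ _).trans
                (mul_le_mul_of_nonneg_left ht.1 (norm_nonneg _))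
            · simp only [indicator_of_notMem ht, map_zero, norm_zero, le_refl]
        _ ≤ ‖(m : ℝ) * ‖ξ‖‖ₑ * μ (B m) ^ (1 / p.toReal) := eLpNorm_indicator_const_le _ _
        _ = _ := by
            rw [enorm_mul, enorm_norm, ENNReal.coe_mul, ENNReal.coe_toNNReal hμB,
              Real.enorm_natCast, ENNReal.coe_natCast]
            ring
    · rw [hind]
      exact (eLpNorm_indicator_le _).trans (hS z)
  have hev : ∀ t, ∀ᶠ m in atTop, (B m).indicator f t = f t := fun t => by
    by_cases h0 : f t = 0
    · exact Eventually.of_forall fun m => by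
        by_cases ht : t ∈ B m
        · rw [indicator_of_mem ht]
        · rw [indicator_of_notMem ht, h0]
    obtain ⟨k, hk⟩ : ∃ k, f t (x k) ≠ 0 := by
      by_contra! hcon
      exact h0 (norm_le_zero_iff.1 ((BddHol.norm_le_iff_of_denseRange hx _ le_rfl).2 fun k => by
        rw [hcon k, norm_zero]))
    have h1 : ∀ᶠ m : ℕ in atTop, 1 / ((m : ℝ) + 1) < ‖f t (x k)‖ :=
      tendsto_one_div_add_atTop_nhds_zero_nat.eventually (gt_mem_nhds (norm_pos_iff.2 hk))
    filter_upwards [h1, eventually_gt_atTop k,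
      tendsto_natCast_atTop_atTop.eventually (eventually_ge_atTop ‖f t‖)] with m hm1 hm2 hm3
    have hmem : t ∈ B m := ⟨hm3, mem_biUnion (Finset.mem_range.2 hm2) hm1.le⟩
    exact indicator_of_mem hmem _
  refine (Lp.eLpNorm_lim_le_liminf_eLpNorm
    (fun m => (measurable_predual_apply (hfm m) ψ).aestronglyMeasurable) _
    (Eventually.of_forall fun t => tendsto_const_nhds.congr' ?_)).trans
    ((liminf_le_liminf (Eventually.of_forall htrunc)).trans_eq (liminf_const _))
  filter_upwards [hev t] with m hm
  rw [hm]

theorem coeFn_transfer (hf : ∀ z, Measurable fun t => f t z) (C : NNReal)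
    (hC : ∀ ψ : Predual O, eLpNorm (fun t => Predual.toDual ψ (f t)) p μ ≤ C * ‖ψ‖ₑ)
    (ψ : Predual O) : transfer hf C hC ψ =ᵐ[μ] fun t => Predual.toDual ψ (f t) :=
  (memLp_predual_apply hf hC ψ).coeFn_toLp

theorem exists_clm_transfer_eq_integral {q : ℝ≥0∞} [ENNReal.HolderConjugate p q]
    (hf : ∀ z, Measurable fun t => f t z) (C : NNReal)
    (hC : ∀ ψ : Predual O, eLpNorm (fun t => Predual.toDual ψ (f t)) p μ ≤ C * ‖ψ‖ₑ)
    {h : Ω → ℂ} (hh : MemLp h q μ) :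
    ∃ L : Predual O →L[ℂ] ℂ, ∀ ψ, L ψ = ∫ t, Predual.toDual ψ (f t) * h t ∂μ := by
  have : Fact (1 ≤ q) := ⟨ENNReal.HolderConjugate.one_le q p⟩
  refine ⟨(((ContinuousLinearMap.mul ℂ ℂ).lpPairing μ p q).flip (hh.toLp h)).comp
    (transfer hf C hC), fun ψ => ?_⟩
  rw [ContinuousLinearMap.comp_apply, ContinuousLinearMap.flip_apply,
    ContinuousLinearMap.lpPairing_eq_integral]
  refine integral_congr_ae ?_
  filter_upwards [coeFn_transfer hf C hC ψ, hh.coeFn_toLp] with t h1 h2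
  rw [h1, h2, ContinuousLinearMap.mul_apply']

theorem transfer_mem_closure_span (hf : ∀ z, Measurable fun t => f t z) (C : NNReal)
    (hC : ∀ ψ : Predual O, eLpNorm (fun t => Predual.toDual ψ (f t)) p μ ≤ C * ‖ψ‖ₑ)
    (ψ : Predual O) : transfer hf C hC ψ ∈
      (Submodule.span ℂ (range fun z => transfer hf C hC (delta z))).topologicalClosure := by
  refine map_mem_closure (transfer hf C hC).continuous (dense_span_delta ψ) fun ξ hξ => ?_
  have := Submodule.mem_map_of_mem (f := (transfer hf C hC).toLinearMap) hξ
  rw [Submodule.map_span, ← range_comp] at this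
  exact this

end Transfer

end HolFubini

open HolFubini in
theorem mainTheorem1 {Ω : Type*} [MeasurableSpace Ω] (μ : Measure Ω)
    (p q : ℝ≥0∞) [Fact (1 ≤ p)] (hp : p ≠ ∞) [ENNReal.HolderConjugate p q]
    {d : ℕ} (O : TopologicalSpace.Opens (Fin d → ℂ)) (f : O → Ω → ℂ)
    (hmeas : ∀ z : O, Measurable (f z))
    (hsup : (⨆ z : O, ∫⁻ t, ‖f z t‖ₑ ^ p.toReal ∂μ) < ∞)
    (hhol : ∀ t : Ω, IsHolomorphic (fun z : O => f z t))
    (hbdd : ∀ t : Ω, ∃ C : ℝ, ∀ z : O, ‖f z t‖ ≤ C) :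
    ∃ F : HInf O (Lp ℂ p μ),
      -- `F(z)` is the class of `f(z, ·)`, and derivatives of `F` are computed pointwise
      (∀ z : O, (F z : Ω → ℂ) =ᵐ[μ] f z) ∧
      (∀ (α : Fin d → ℕ) (a : O),
        ((multiDeriv α F a : Lp ℂ p μ) : Ω → ℂ) =ᵐ[μ]
          fun t => multiDeriv α (fun z : O => f z t) a) ∧
      -- differentiation under the integral
      (∀ h : Ω → ℂ, MemLp h q μ →
        IsHolomorphic (fun z : O => ∫ t, f z t * h t ∂μ) ∧
        ∀ (α : Fin d → ℕ) (a : O),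
          Integrable (fun t => multiDeriv α (fun z : O => f z t) a * h t) μ ∧
          multiDeriv α (fun z : O => ∫ t, f z t * h t ∂μ) a =
            ∫ t, multiDeriv α (fun z : O => f z t) a * h t ∂μ) ∧
      -- bp-continuous functionals
      (∀ (φ : HInf O ℂ →ₗ[ℂ] ℂ) (hφ : IsBPContinuous φ),
        Measurable (fun t => φ (HInf.ofBounded (fun z => f z t) (hhol t) (hbdd t))) ∧
        (∃ hL : MemLp (fun t => φ (HInf.ofBounded (fun z => f z t) (hhol t) (hbdd t))) p μ,
          (∫ t, ‖φ (HInf.ofBounded (fun z => f z t) (hhol t) (hbdd t))‖ ^ p.toReal ∂μ)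
              ^ (1 / p.toReal) ≤ ‖hφ.toDual‖ * ⨆ z : O, ‖F z‖ ∧
          hL.toLp _ ∈
            (Submodule.span ℂ (Set.range (F : O → Lp ℂ p μ))).topologicalClosure) ∧
        ∀ h : Ω → ℂ, MemLp h q μ →
          Integrable
            (fun t => φ (HInf.ofBounded (fun z => f z t) (hhol t) (hbdd t)) * h t) μ ∧
          ∃ G : HInf O ℂ, (∀ z : O, G z = ∫ t, f z t * h t ∂μ) ∧
            ∫ t, φ (HInf.ofBounded (fun z => f z t) (hhol t) (hbdd t)) * h t ∂μ = φ G) := by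
  have hp0 : p ≠ 0 := (zero_lt_one.trans_le (Fact.out : 1 ≤ p)).ne'
  set g : Ω → BddHol O := fun t => HInf.ofBounded (fun z => f z t) (hhol t) (hbdd t)
  have hgm : ∀ z, Measurable fun t => g t z := hmeas
  have hSfin : (⨆ z : O, ∫⁻ t, ‖f z t‖ₑ ^ p.toReal ∂μ) ^ (1 / p.toReal) ≠ ∞ :=
    ENNReal.rpow_ne_top_of_nonneg (by positivity) hsup.ne
  set S : NNReal := ((⨆ z : O, ∫⁻ t, ‖f z t‖ₑ ^ p.toReal ∂μ) ^ (1 / p.toReal)).toNNReal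
  have hS : ∀ z, eLpNorm (fun t => g t z) p μ ≤ S := fun z => by
    rw [ENNReal.coe_toNNReal hSfin, eLpNorm_eq_lintegral_rpow_enorm_toReal hp0 hp]
    exact ENNReal.rpow_le_rpow (le_iSup (fun z : O => ∫⁻ t, ‖f z t‖ₑ ^ p.toReal ∂μ) z)
      (by positivity)
  have hC := eLpNorm_predual_apply_le hp hgm hS
  set T := transfer hgm S hC
  have hderiv : ∀ α a t, Predual.toDual (multiDeriv α delta a) (g t)
      = multiDeriv α (fun z : O => f z t) a := fun α a t => toDual_multiDeriv_delta α a (g t)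
  set F : HInf O (Lp ℂ p μ) := HInf.ofBounded (fun z => T (delta z))
    (isHolomorphic_delta.clm_comp T) ⟨‖T‖, fun z => T.unit_le_opNorm _ (norm_delta_le z)⟩
  refine ⟨F, fun z => coeFn_transfer hgm S hC (delta z), fun α a => ?_, fun h hh => ?_,
    fun φ hφ => ?_⟩
  · have h1 : multiDeriv α F a = T (multiDeriv α delta a) :=
      multiDeriv_clm_comp T isHolomorphic_delta α a
    rw [h1]
    filter_upwards [coeFn_transfer hgm S hC (multiDeriv α delta a)] with t ht
    rw [ht, hderiv]
  · obtain ⟨L, hL⟩ := exists_clm_transfer_eq_integral hgm S hC hh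
    have hLδ : (fun z : O => ∫ t, f z t * h t ∂μ) = fun z => L (delta z) :=
      funext fun z => (hL (delta z)).symm
    rw [hLδ]
    refine ⟨isHolomorphic_delta.clm_comp L, fun α a => ⟨?_, ?_⟩⟩
    · have := (memLp_predual_apply hgm hC (multiDeriv α delta a)).integrable_mul hh
      refine this.congr (Eventually.of_forall fun t => ?_)
      simp only [Pi.mul_apply, hderiv]
    · rw [multiDeriv_clm_comp L isHolomorphic_delta α a, hL]
      simp only [hderiv]
  · let ψ : Predual O := ⟨hφ.toStrongDual, hφ.toStrongDual_mem⟩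
    have hmem : MemLp (fun t => φ (g t)) p μ := memLp_predual_apply hgm hC ψ
    refine ⟨measurable_predual_apply hgm ψ, ⟨hmem, ?_, ?_⟩,
      fun h hh => ⟨hmem.integrable_mul hh, ?_⟩⟩
    · -- The central estimate is applied again, now with the sharp bound.
      have hFbdd : BddAbove (Set.range fun z : O => ‖F z‖) :=
        ⟨‖T‖, by rintro _ ⟨z, rfl⟩; exact T.unit_le_opNorm _ (norm_delta_le z)⟩
      obtain ⟨M, hM⟩ : ∃ M : NNReal, (M : ℝ) = ⨆ z : O, ‖F z‖ :=
        ⟨⟨_, Real.iSup_nonneg fun z => norm_nonneg _⟩, rfl⟩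
      have hgM : ∀ z, eLpNorm (fun t => g t z) p μ ≤ M := fun z => by
        have h1 : eLpNorm (fun t => g t z) p μ = ‖F z‖ₑ :=
          (Lp.enorm_toLp (memLp_predual_apply hgm hC (delta z))).symm
        have h2 : ‖F z‖ ≤ M := hM ▸ le_ciSup hFbdd z
        rw [h1, ← ofReal_norm, ← ENNReal.ofReal_coe_nnreal]
        exact ENNReal.ofReal_le_ofReal h2
      have hle : eLpNorm (fun t => φ (g t)) p μ ≤ M * ‖ψ‖ₑ :=
        eLpNorm_predual_apply_le hp hgm hgM ψ
      have hfin : (M : ℝ≥0∞) * ‖ψ‖ₑ ≠ ∞ := ENNReal.mul_ne_top ENNReal.coe_ne_top enorm_ne_top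
      have hle' := ENNReal.toReal_mono hfin hle
      rw [toReal_eLpNorm hmem.1, lpNorm_eq_integral_norm_rpow_toReal hp0 hp hmem.1,
        ENNReal.toReal_mul, ENNReal.coe_toReal, toReal_enorm, hM, mul_comm, ← one_div] at hle'
      exact hle'
    · exact transfer_mem_closure_span hgm S hC ψ
    · obtain ⟨L, hL⟩ := exists_clm_transfer_eq_integral hgm S hC hh
      obtain ⟨G, hG, hGψ⟩ := exists_bddHol_of_clm L
      exact ⟨G, fun z => (hG z).trans (hL (delta z)), ((hGψ ψ).trans (hL ψ)).symm⟩
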